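/- Let $n\ge 1$ and let $M^{2n+1}$ be a smooth Hausdorff manifold with an almost contact metric structure $(\phi,\xi,\eta,g)$: $g$ is a Riemannian metric, $\phi$ a smooth $(1,1)$-tensor field, $\xi$ a smooth vector field and $\eta$ a smooth $1$-form with $\phi^2=-I+\eta\otimes\xi$, $\eta(\xi)=1$ and $g(\phi X,\phi Y)=g(X,Y)-\eta(X)\eta(Y)$. Let $\alpha\in\mathbb R$ and assume that the structure is almost $\alpha$-cosymplectic, i.e. $d\eta=0$ and $d\Phi=2\alpha\,\eta\wedge\Phi$, where $\Phi(X,Y)=g(\phi X,Y)$. Let $\nabla$ be the Levi-Civita connection of $g$, $R(X,Y)Z=\nabla_X\nabla_YZ-\nabla_Y\nabla_XZ-\nabla_{[X,Y]}Z$ its curvature tensor, $h=\tfrac12\mathcal L_\xi\phi$ and $\mathcal D=\ker\eta$. Suppose that 1. $\nabla_\xi h=0$; 2. there is a point $p\in M$ such that every plane in $T_pM$ containing $\xi_p$ has sectional curvature $\ne\alpha^2$; 3. there is a function $\lambda:M\to\mathbb R$ such that, at every point, $\mathcal D$ is the sum $D(\lambda)+D(-\lambda)$ of the spaces $D(\pm\lambda)=\{X\in\mathcal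 D: hX=\pm\lambda X\}$ (a direct sum wherever $\lambda\neq0$); 4. $h$ is $\eta$-parallel, i.e. $g((\nabla_Xh)Y,Z)=0$ for all vector fields $X,Y,Z$ orthogonal to $\xi$. Then $M$ is an almost $\alpha$-cosymplectic $(\kappa,0,2\alpha)$-space with $\kappa=-(\alpha^2+\lambda^2)$. That is, $\kappa$ is a smooth function with $d\kappa\wedge\eta=0$, and for all vector fields $X,Y$ $$R(X,Y)\xi=\eta(Y)\bigl(\kappa X+2\alpha\,\phi hX\bigr)-\eta(X)\bigl(\kappa Y+2\alpha\,\phi hY\bigr).$$ -/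

import Mathlib

/-!
Almost contact metric geometry on a smooth Riemannian manifold: the Levi-Civita connection
(built from the Koszul formula), its curvature, almost contact metric structures, almost
`α`-cosymplectic manifolds, the tensor `h`, `η`-parallelism and `(κ, μ, ν)`-spaces.
-/

open Bundle VectorField FiberBundle
open scoped Manifold ContDiff

noncomputable section

namespace AlmostContact

variable {E : Type*} [NormedAddCommGroup E] [NormedSpace ℝ E]
  {H : Type*} [TopologicalSpace H] {I : ModelWithCorners ℝ E H}
  {M : Type*} [TopologicalSpace M] [ChartedSpace H M]
  [RiemannianBundle (fun x : M => TangentSpace I x)]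

variable (I) in
/-- The Koszul expression, i.e. the value that `g(∇_X Y, Z)` must have for the torsion-free
metric connection `∇`. -/
def koszul (X Y Z : Π x : M, TangentSpace I x) (x : M) : ℝ :=
  (1 / 2 : ℝ) *
    (d% (fun y => inner ℝ (Y y) (Z y)) x (X x)
      + d% (fun y => inner ℝ (Z y) (X y)) x (Y x)
      - d% (fun y => inner ℝ (X y) (Y y)) x (Z x)
      + inner ℝ (mlieBracket I X Y x) (Z x)
      - inner ℝ (mlieBracket I Y Z x) (X x)
      + inner ℝ (mlieBracket I Z X x) (Y x))

variable [IsManifold I ∞ M]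
  [IsContMDiffRiemannianBundle I ∞ E (fun x : M => TangentSpace I x)]

theorem inner_tangent {Y Z : Π x : M, TangentSpace I x} {x : M}
    (hY : MDiffAt (T% Y) x) (hZ : MDiffAt (T% Z) x) :
    MDiffAt (fun y => inner ℝ (Y y) (Z y)) x :=
  MDifferentiableAt.inner_bundle (F := E) (E := fun x : M => TangentSpace I x) hY hZ

variable [FiniteDimensional ℝ E]

theorem koszul_tensorial_left {Y Z : Π x : M, TangentSpace I x} {x : M}
    (hY : MDiffAt (T% Y) x) (hZ : MDiffAt (T% Z) x) :
    TensorialAt I E (fun X : Π x : M, TangentSpace I x => koszul I X Y Z x) x where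
  smul {f X} hf hX := by
    have := FiniteDimensional.complete ℝ E
    have h1 : (fun y => inner ℝ (Z y) ((f • X) y)) = f * (fun y => inner ℝ (Z y) (X y)) := by
      ext y; simp [inner_smul_right]
    have h2 : (fun y => inner ℝ ((f • X) y) (Y y)) = f * (fun y => inner ℝ (X y) (Y y)) := by
      ext y; simp [inner_smul_left]
    simp only [koszul, h1, h2, mvfderiv_mul hf (inner_tangent hZ hX),
      mvfderiv_mul hf (inner_tangent hX hY), mlieBracket_smul_left hf hX,
      mlieBracket_smul_right hf hX]
    simp [inner_add_left, inner_smul_left, inner_smul_right, real_inner_comm]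
    ring
  add {X X'} hX hX' := by
    have := FiniteDimensional.complete ℝ E
    have h1 : (fun y => inner ℝ (Z y) ((X + X') y))
        = (fun y => inner ℝ (Z y) (X y)) + (fun y => inner ℝ (Z y) (X' y)) := by
      ext y; simp [inner_add_right]
    have h2 : (fun y => inner ℝ ((X + X') y) (Y y))
        = (fun y => inner ℝ (X y) (Y y)) + (fun y => inner ℝ (X' y) (Y y)) := by
      ext y; simp [inner_add_left]
    simp only [koszul, h1, h2, mvfderiv_add (inner_tangent hZ hX) (inner_tangent hZ hX'),
      mvfderiv_add (inner_tangent hX hY) (inner_tangent hX' hY), mlieBracket_add_left hX hX',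
      mlieBracket_add_right hX hX']
    simp [inner_add_left, inner_add_right]
    ring

theorem koszul_tensorial_right {X Y : Π x : M, TangentSpace I x} {x : M}
    (hX : MDiffAt (T% X) x) (hY : MDiffAt (T% Y) x) :
    TensorialAt I E (fun Z : Π x : M, TangentSpace I x => koszul I X Y Z x) x where
  smul {f Z} hf hZ := by
    have := FiniteDimensional.complete ℝ E
    have h1 : (fun y => inner ℝ (Y y) ((f • Z) y)) = f * (fun y => inner ℝ (Y y) (Z y)) := by
      ext y; simp [inner_smul_right]
    have h2 : (fun y => inner ℝ ((f • Z) y) (X y)) = f * (fun y => inner ℝ (Z y) (X y)) := by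
      ext y; simp [inner_smul_left]
    simp only [koszul, h1, h2, mvfderiv_mul hf (inner_tangent hY hZ),
      mvfderiv_mul hf (inner_tangent hZ hX), mlieBracket_smul_left hf hZ,
      mlieBracket_smul_right hf hZ]
    simp [inner_add_left, inner_smul_left, inner_smul_right, real_inner_comm]
    ring
  add {Z Z'} hZ hZ' := by
    have := FiniteDimensional.complete ℝ E
    have h1 : (fun y => inner ℝ (Y y) ((Z + Z') y))
        = (fun y => inner ℝ (Y y) (Z y)) + (fun y => inner ℝ (Y y) (Z' y)) := by
      ext y; simp [inner_add_right]
    have h2 : (fun y => inner ℝ ((Z + Z') y) (X y))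
        = (fun y => inner ℝ (Z y) (X y)) + (fun y => inner ℝ (Z' y) (X y)) := by
      ext y; simp [inner_add_left]
    simp only [koszul, h1, h2, mvfderiv_add (inner_tangent hY hZ) (inner_tangent hY hZ'),
      mvfderiv_add (inner_tangent hZ hX) (inner_tangent hZ' hX), mlieBracket_add_left hZ hZ',
      mlieBracket_add_right hZ hZ']
    simp [inner_add_left, inner_add_right]
    ring


theorem koszul_add_middle {X Y Y' Z : Π x : M, TangentSpace I x} {x : M}
    (hX : MDiffAt (T% X) x) (hY : MDiffAt (T% Y) x) (hY' : MDiffAt (T% Y') x)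
    (hZ : MDiffAt (T% Z) x) :
    koszul I X (Y + Y') Z x = koszul I X Y Z x + koszul I X Y' Z x := by
  have := FiniteDimensional.complete ℝ E
  have h1 : (fun y => inner ℝ ((Y + Y') y) (Z y))
      = (fun y => inner ℝ (Y y) (Z y)) + (fun y => inner ℝ (Y' y) (Z y)) := by
    ext y; simp [inner_add_left]
  have h2 : (fun y => inner ℝ (X y) ((Y + Y') y))
      = (fun y => inner ℝ (X y) (Y y)) + (fun y => inner ℝ (X y) (Y' y)) := by
    ext y; simp [inner_add_right]
  simp only [koszul, h1, h2, mvfderiv_add (inner_tangent hY hZ) (inner_tangent hY' hZ),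
    mvfderiv_add (inner_tangent hX hY) (inner_tangent hX hY'), mlieBracket_add_left hY hY',
    mlieBracket_add_right hY hY']
  simp [inner_add_left, inner_add_right]
  ring

theorem koszul_smul_middle {f : M → ℝ} {X Y Z : Π x : M, TangentSpace I x} {x : M}
    (hf : MDiffAt f x) (hX : MDiffAt (T% X) x) (hY : MDiffAt (T% Y) x)
    (hZ : MDiffAt (T% Z) x) :
    koszul I X (f • Y) Z x
      = f x * koszul I X Y Z x + d% f x (X x) * inner ℝ (Y x) (Z x) := by
  have := FiniteDimensional.complete ℝ E
  have h1 : (fun y => inner ℝ ((f • Y) y) (Z y)) = f * (fun y => inner ℝ (Y y) (Z y)) := by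
    ext y; simp [inner_smul_left]
  have h2 : (fun y => inner ℝ (X y) ((f • Y) y)) = f * (fun y => inner ℝ (X y) (Y y)) := by
    ext y; simp [inner_smul_right]
  simp only [koszul, h1, h2, mvfderiv_mul hf (inner_tangent hY hZ),
    mvfderiv_mul hf (inner_tangent hX hY), mlieBracket_smul_left hf hY,
    mlieBracket_smul_right hf hY]
  simp [inner_add_left, inner_smul_left, inner_smul_right, real_inner_comm]
  ring

/-- For fixed `Y`, the Koszul expression as a bilinear form in the tangent vectors `X`, `Z`. -/
def koszulForm (Y : Π x : M, TangentSpace I x) (x : M) (hY : MDiffAt (T% Y) x) :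
    TangentSpace I x →L[ℝ] TangentSpace I x →L[ℝ] ℝ :=
  TensorialAt.mkHom₂ (fun X Z : Π x : M, TangentSpace I x => koszul I X Y Z x) x
    (fun _ hZ => koszul_tensorial_left hY hZ) (fun _ hX => koszul_tensorial_right hX hY)

instance finiteDimensional_tangentSpace (x : M) : FiniteDimensional ℝ (TangentSpace I x) :=
  inferInstanceAs (FiniteDimensional ℝ E)

/-- The endomorphism `v ↦ ∇_v Y` at `x`, the `g`-dual of the Koszul form, written in an orthonormal
basis of the tangent space. -/
def koszulDeriv (Y : Π x : M, TangentSpace I x) (x : M) (hY : MDiffAt (T% Y) x) :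
    TangentSpace I x →L[ℝ] TangentSpace I x :=
  ∑ i, ((koszulForm Y x hY).flip (stdOrthonormalBasis ℝ (TangentSpace I x) i)).smulRight
    (stdOrthonormalBasis ℝ (TangentSpace I x) i)

theorem inner_koszulDeriv {X Y Z : Π x : M, TangentSpace I x} {x : M}
    (hX : MDiffAt (T% X) x) (hY : MDiffAt (T% Y) x) (hZ : MDiffAt (T% Z) x) :
    inner ℝ (koszulDeriv Y x hY (X x)) (Z x) = koszul I X Y Z x := by
  have h : koszulForm Y x hY (X x) (Z x) = koszul I X Y Z x :=
    TensorialAt.mkHom₂_apply _ _ hX hZ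
  rw [← h]
  conv_rhs => rw [← (stdOrthonormalBasis ℝ (TangentSpace I x)).sum_repr' (Z x)]
  simp [koszulDeriv, sum_inner, inner_smul_left, mul_comm]

open Classical in
/-- The Levi-Civita connection of the Riemannian manifold `M`. In Mathlib's argument order
`leviCivita Y x v` is `(∇_v Y)(x)`. -/
def leviCivita : CovariantDerivative I E (TangentSpace I : M → Type _) where
  toFun Y x := if hY : MDiffAt (T% Y) x then koszulDeriv Y x hY else 0
  isCovariantDerivativeOnUniv := by
    constructor
    · intro Y Y' x hY hY' _
      have hYY' : MDiffAt (T% (Y + Y')) x := mdifferentiableAt_add_section hY hY'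
      simp only [hY, hY', hYY', dif_pos]
      ext v
      refine ext_inner_right ℝ fun w => ?_
      obtain ⟨X, hX, rfl⟩ : ∃ X : Π x : M, TangentSpace I x, MDiffAt (T% X) x ∧ X x = v :=
        ⟨extend E v, mdifferentiableAt_extend .., by simp⟩
      obtain ⟨Z, hZ, rfl⟩ : ∃ X : Π x : M, TangentSpace I x, MDiffAt (T% X) x ∧ X x = w :=
        ⟨extend E w, mdifferentiableAt_extend .., by simp⟩
      rw [inner_koszulDeriv hX hYY' hZ, koszul_add_middle hX hY hY' hZ, add_apply, inner_add_left,
        inner_koszulDeriv hX hY hZ, inner_koszulDeriv hX hY' hZ]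
    · intro Y f x hY hf _
      have hfY : MDiffAt (T% (f • Y)) x := hf.smul_section hY
      simp only [hY, hfY, dif_pos]
      ext v
      refine ext_inner_right ℝ fun w => ?_
      obtain ⟨X, hX, rfl⟩ : ∃ X : Π x : M, TangentSpace I x, MDiffAt (T% X) x ∧ X x = v :=
        ⟨extend E v, mdifferentiableAt_extend .., by simp⟩
      obtain ⟨Z, hZ, rfl⟩ : ∃ X : Π x : M, TangentSpace I x, MDiffAt (T% X) x ∧ X x = w :=
        ⟨extend E w, mdifferentiableAt_extend .., by simp⟩
      rw [inner_koszulDeriv hX hfY hZ, koszul_smul_middle hf hX hY hZ]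
      simp [inner_add_left, inner_smul_left, inner_koszulDeriv hX hY hZ]

theorem inner_leviCivita {X Y Z : Π x : M, TangentSpace I x} {x : M}
    (hX : MDiffAt (T% X) x) (hY : MDiffAt (T% Y) x) (hZ : MDiffAt (T% Z) x) :
    inner ℝ (leviCivita Y x (X x)) (Z x) = koszul I X Y Z x := by
  simp only [leviCivita, hY, dif_pos]
  exact inner_koszulDeriv hX hY hZ

/-- The Levi-Civita connection is torsion-free. -/
theorem leviCivita_torsion [CompleteSpace E] :
    (leviCivita : CovariantDerivative I E (TangentSpace I : M → Type _)).torsion = 0 := by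
  rw [CovariantDerivative.torsion_eq_zero_iff]
  intro X Y x hX hY
  refine ext_inner_right ℝ fun w => ?_
  obtain ⟨Z, hZ, rfl⟩ : ∃ X : Π x : M, TangentSpace I x, MDiffAt (T% X) x ∧ X x = w :=
    ⟨extend E w, mdifferentiableAt_extend .., by simp⟩
  rw [inner_sub_left, inner_leviCivita hX hY hZ, inner_leviCivita hY hX hZ]
  simp only [koszul, real_inner_comm]
  rw [mlieBracket_swap_apply (V := Y) (W := X), mlieBracket_swap_apply (V := Z) (W := Y),
    mlieBracket_swap_apply (V := X) (W := Z)]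
  simp only [inner_neg_right]
  ring

/-- The Levi-Civita connection is metric: `X g(Y, Z) = g(∇_X Y, Z) + g(Y, ∇_X Z)`. -/
theorem leviCivita_metric {X Y Z : Π x : M, TangentSpace I x} {x : M}
    (hX : MDiffAt (T% X) x) (hY : MDiffAt (T% Y) x) (hZ : MDiffAt (T% Z) x) :
    d% (fun y => inner ℝ (Y y) (Z y)) x (X x)
      = inner ℝ (leviCivita Y x (X x)) (Z x) + inner ℝ (Y x) (leviCivita Z x (X x)) := by
  rw [inner_leviCivita hX hY hZ, real_inner_comm (leviCivita Z x (X x)),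
    inner_leviCivita hX hZ hY]
  simp only [koszul, real_inner_comm]
  rw [mlieBracket_swap_apply (V := Z) (W := Y), mlieBracket_swap_apply (V := Z) (W := X),
    mlieBracket_swap_apply (V := Y) (W := X)]
  simp only [inner_neg_right]
  ring

/-- `X` is a smooth vector field on `M`. -/
def IsSmoothField (X : Π x : M, TangentSpace I x) : Prop := CMDiff ∞ (T% X)

/-- The vector field `∇_X Y`. -/
def nabla (X Y : Π x : M, TangentSpace I x) (x : M) : TangentSpace I x :=
  leviCivita Y x (X x)

/-- The covariant derivative `(∇_X B) Y = ∇_X (B Y) - B (∇_X Y)` of a `(1,1)`-tensor field `B`. -/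
def nablaEnd (B : Π x : M, TangentSpace I x →L[ℝ] TangentSpace I x)
    (X Y : Π x : M, TangentSpace I x) (x : M) : TangentSpace I x :=
  nabla X (fun y => B y (Y y)) x - B x (nabla X Y x)

/-- The curvature tensor `R(X, Y) Z = ∇_X ∇_Y Z - ∇_Y ∇_X Z - ∇_[X, Y] Z`. -/
def curvature (X Y Z : Π x : M, TangentSpace I x) (x : M) : TangentSpace I x :=
  nabla X (nabla Y Z) x - nabla Y (nabla X Z) x - nabla (mlieBracket I X Y) Z x

/-- The sectional curvature at `x` of the plane spanned by `X x` and `Y x`, for smooth vector fields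
`X`, `Y` that are linearly independent at `x`. -/
def sectionalCurvature (X Y : Π x : M, TangentSpace I x) (x : M) : ℝ :=
  inner ℝ (curvature X Y Y x) (X x) /
    (inner ℝ (X x) (X x) * inner ℝ (Y x) (Y x) - inner ℝ (X x) (Y x) ^ 2)

variable (I M) in
/-- An almost contact metric structure `(φ, ξ, η, g)` on the Riemannian manifold `(M, g)`. -/
structure AlmostContactMetricStructure where
  /-- the field of endomorphisms `φ` -/
  phi : Π x : M, TangentSpace I x →L[ℝ] TangentSpace I x
  /-- the characteristic (Reeb) vector field `ξ` -/
  xi : Π x : M, TangentSpace I x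
  /-- the 1-form `η` -/
  eta : Π x : M, TangentSpace I x →L[ℝ] ℝ
  contMDiff_phi : ContMDiff I (I.prod 𝓘(ℝ, E →L[ℝ] E)) ∞
    (fun x => TotalSpace.mk' (E →L[ℝ] E)
      (E := fun x : M => TangentSpace I x →L[ℝ] TangentSpace I x) x (phi x))
  contMDiff_xi : IsSmoothField xi
  contMDiff_eta : ContMDiff I (I.prod 𝓘(ℝ, E →L[ℝ] ℝ)) ∞
    (fun x => TotalSpace.mk' (E →L[ℝ] ℝ)
      (E := fun x : M => TangentSpace I x →L[ℝ] Bundle.Trivial M ℝ x) x (eta x))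
  phi_phi : ∀ (x : M) (v : TangentSpace I x), phi x (phi x v) = -v + eta x v • xi x
  eta_xi : ∀ x : M, eta x (xi x) = 1
  inner_phi_phi : ∀ (x : M) (v w : TangentSpace I x),
    inner ℝ (phi x v) (phi x w) = inner ℝ v w - eta x v * eta x w

/-- The exterior derivative of a 1-form,
`dθ(X, Y) = X θ(Y) - Y θ(X) - θ([X, Y])`, on smooth vector fields. -/
def dOneForm (θ : Π x : M, TangentSpace I x → ℝ) (X Y : Π x : M, TangentSpace I x) (x : M) : ℝ :=
  d% (fun y => θ y (Y y)) x (X x) - d% (fun y => θ y (X y)) x (Y x) - θ x (mlieBracket I X Y x)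

/-- The exterior derivative of a 2-form on smooth vector fields. -/
def dTwoForm (Ω : Π x : M, TangentSpace I x → TangentSpace I x → ℝ)
    (X Y Z : Π x : M, TangentSpace I x) (x : M) : ℝ :=
  d% (fun y => Ω y (Y y) (Z y)) x (X x)
    + d% (fun y => Ω y (Z y) (X y)) x (Y x)
    + d% (fun y => Ω y (X y) (Y y)) x (Z x)
    - Ω x (mlieBracket I X Y x) (Z x)
    - Ω x (mlieBracket I Y Z x) (X x)
    - Ω x (mlieBracket I Z X x) (Y x)

/-- The wedge product of a 1-form and a 2-form (normalized consistently with `dTwoForm`). -/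
def wedgeOneTwo (θ : Π x : M, TangentSpace I x → ℝ)
    (Ω : Π x : M, TangentSpace I x → TangentSpace I x → ℝ)
    (X Y Z : Π x : M, TangentSpace I x) (x : M) : ℝ :=
  θ x (X x) * Ω x (Y x) (Z x) + θ x (Y x) * Ω x (Z x) (X x) + θ x (Z x) * Ω x (X x) (Y x)

namespace AlmostContactMetricStructure

variable (S : AlmostContactMetricStructure I M)

/-- The fundamental 2-form `Φ(v, w) = g(φ v, w)`. -/
def Phi (x : M) (v w : TangentSpace I x) : ℝ := inner ℝ (S.phi x v) w

/-- The structure is almost `α`-cosymplectic: `dη = 0` and `dΦ = 2 α η ∧ Φ`. -/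
structure IsAlmostCosymplectic (α : ℝ) : Prop where
  d_eta : ∀ X Y : Π x : M, TangentSpace I x, IsSmoothField X → IsSmoothField Y →
    ∀ x, dOneForm (fun y v => S.eta y v) X Y x = 0
  d_Phi : ∀ X Y Z : Π x : M, TangentSpace I x,
    IsSmoothField X → IsSmoothField Y → IsSmoothField Z →
    ∀ x, dTwoForm S.Phi X Y Z x = 2 * α * wedgeOneTwo (fun y v => S.eta y v) S.Phi X Y Z x

/-- The Lie derivative `(L_ξ φ) X = [ξ, φ X] - φ [ξ, X]`. -/
def lieXiPhi (X : Π x : M, TangentSpace I x) (x : M) : TangentSpace I x :=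
  mlieBracket I S.xi (fun y => S.phi y (X y)) x - S.phi x (mlieBracket I S.xi X x)

theorem mdifferentiableAt_phi {X : Π x : M, TangentSpace I x} {x : M}
    (hX : MDiffAt (T% X) x) : MDiffAt (T% (fun y => S.phi y (X y))) x :=
  MDifferentiableAt.clm_bundle_apply (b := fun y : M => y)
    (S.contMDiff_phi.mdifferentiableAt (by simp)) hX

theorem lieXiPhi_tensorial (x : M) : TensorialAt I E (fun X => S.lieXiPhi X x) x where
  smul {f X} hf hX := by
    have := FiniteDimensional.complete ℝ E
    have h1 : (fun y => S.phi y ((f • X) y)) = f • (fun y => S.phi y (X y)) := by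
      ext y; simp
    simp only [lieXiPhi, h1, mlieBracket_smul_right hf (S.mdifferentiableAt_phi hX),
      mlieBracket_smul_right hf hX]
    simp [smul_sub]
  add {X X'} hX hX' := by
    have := FiniteDimensional.complete ℝ E
    have h1 : (fun y => S.phi y ((X + X') y))
        = (fun y => S.phi y (X y)) + (fun y => S.phi y (X' y)) := by
      ext y; simp
    simp only [lieXiPhi, h1, mlieBracket_add_right (S.mdifferentiableAt_phi hX)
      (S.mdifferentiableAt_phi hX'), mlieBracket_add_right hX hX']
    simp
    abel

/-- The tensor field `h = (1/2) L_ξ φ`. -/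
def h (x : M) : TangentSpace I x →L[ℝ] TangentSpace I x :=
  (1 / 2 : ℝ) • TensorialAt.mkHom (fun X => S.lieXiPhi X x) x (S.lieXiPhi_tensorial x)

theorem h_apply {X : Π x : M, TangentSpace I x} {x : M} (hX : MDiffAt (T% X) x) :
    S.h x (X x) = (1 / 2 : ℝ) • S.lieXiPhi X x := by
  rw [h, smul_apply, TensorialAt.mkHom_apply _ hX]

/-- The distribution `D = ker η`, the orthogonal complement of `ξ`. -/
def D (x : M) : Submodule ℝ (TangentSpace I x) :=
  LinearMap.ker (S.eta x : TangentSpace I x →ₗ[ℝ] ℝ)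

/-- The space `D(c)` of the `X ∈ D` at `x` with `h X = c X`. -/
def eigenD (x : M) (c : ℝ) : Submodule ℝ (TangentSpace I x) :=
  S.D x ⊓ Module.End.eigenspace (S.h x : TangentSpace I x →ₗ[ℝ] TangentSpace I x) c

/-- A `(1,1)`-tensor field `B` is `η`-parallel: `g((∇_X B) Y, Z) = 0` for all `X`, `Y`, `Z`
orthogonal to `ξ`. -/
def IsEtaParallel (B : Π x : M, TangentSpace I x →L[ℝ] TangentSpace I x) : Prop :=
  ∀ X Y Z : Π x : M, TangentSpace I x,
    IsSmoothField X → IsSmoothField Y → IsSmoothField Z →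
    (∀ x, X x ∈ S.D x) → (∀ x, Y x ∈ S.D x) → (∀ x, Z x ∈ S.D x) →
    ∀ x, inner ℝ (nablaEnd B X Y x) (Z x) = 0

/-- The ring of smooth functions `f` with `df ∧ η = 0`. -/
def MemREta (f : M → ℝ) : Prop :=
  CMDiff ∞ f ∧ ∀ (x : M) (v w : TangentSpace I x),
    d% f x v * S.eta x w - d% f x w * S.eta x v = 0

/-- `M` is an almost `α`-cosymplectic `(κ, μ, ν)`-space:
`R(X, Y) ξ = η(Y) (κ I + μ h + ν φ h) X - η(X) (κ I + μ h + ν φ h) Y`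
with `κ`, `μ`, `ν` smooth functions satisfying `dκ ∧ η = dμ ∧ η = dν ∧ η = 0`. -/
structure IsKappaMuNuSpace (α : ℝ) (κ μ ν : M → ℝ) : Prop where
  isAlmostCosymplectic : S.IsAlmostCosymplectic α
  kappa_mem : S.MemREta κ
  mu_mem : S.MemREta μ
  nu_mem : S.MemREta ν
  curvature_xi : ∀ X Y : Π x : M, TangentSpace I x, IsSmoothField X → IsSmoothField Y →
    ∀ x, curvature X Y S.xi x
      = S.eta x (Y x) •
          (κ x • X x + μ x • S.h x (X x) + ν x • S.phi x (S.h x (X x)))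
        - S.eta x (X x) •
          (κ x • Y x + μ x • S.h x (Y x) + ν x • S.phi x (S.h x (Y x)))

end AlmostContactMetricStructure

end AlmostContact

end

/-!
The endomorphism `A = ∇ξ` controls everything. Closedness of `η` makes `A` symmetric, and the
contraction of `dΦ = 2 α η ∧ Φ` with `ξ`, combined with the `ξ`-derivative of `φ² = -1 + η ⊗ ξ`,
gives `∇_ξ φ = 0` and `φ A + A φ = 2 α φ`. Hence `h = φ A - α φ` is symmetric, anticommutes with `φ`,
and `A = α (1 - η ⊗ ξ) - φ h` (`nablaXi_eq`). As `∇` has no torsion, `R(X, Y) ξ` is the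
skew-symmetrization of `(∇_X A) Y`, so it is determined by `(∇_X φ) h Y + φ (∇_X h) Y`
(`curvature_xi_eq`).

The hypotheses on `∇h` make `(∇_X h) Y` a multiple of `ξ` for `Y` in `D`, while
`(∇_X h) ξ = -h A X` is computed from `h² = λ²` on `D`. It remains to see that, for `X`, `Y` in `D`,
`(∇_X φ) h Y` is a multiple of `ξ` (with a coefficient symmetric in `X` and `Y`, which then cancels).
This is clear at points where `λ = 0`, since `h = 0` there. Where `λ ≠ 0`, differentiating
`φ h + h φ = 0` shows that `∇_X φ` exchanges `D(λ)` and `D(-λ)` modulo `ξ`. For `X`, `Y`, `Z` in the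
same eigenspace, `g((∇_X φ) Y, φ Z)` is symmetric in `X`, `Y` because `dΦ` vanishes on `D`, and skew
in `Y`, `Z` because `φ² = -1` on `D`; so it vanishes (`inner_covPhi_phi_eigenD`), and with it the
`D`-component of `(∇_X φ) Y` for all `X`, `Y` in `D`. All of this is pointwise, so the possible zeros
of `λ` do no harm.

Finally `λ²` is smooth, being the quotient `g(hY, hY) / g(Y, Y)` for a local field `Y` in `D`, and
differentiating this relation shows that it is locally constant (`mvfderiv_sq_eigenvalue`).
-/

namespace AlmostContact

variable {E : Type*} [NormedAddCommGroup E] [NormedSpace ℝ E]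
  {H : Type*} [TopologicalSpace H] {I : ModelWithCorners ℝ E H}
  {M : Type*} [TopologicalSpace M] [ChartedSpace H M] [IsManifold I ∞ M]

/-! ### Smooth vector fields -/

namespace IsSmoothField

variable {X Y : Π x : M, TangentSpace I x}

theorem mdifferentiableAt (hX : IsSmoothField X) (x : M) : MDiffAt (T% X) x :=
  (hX x).mdifferentiableAt (by simp)

theorem sub (hX : IsSmoothField X) (hY : IsSmoothField Y) : IsSmoothField (X - Y) :=
  ContMDiff.sub_section hX hY

theorem neg (hX : IsSmoothField X) : IsSmoothField (-X) :=
  ContMDiff.neg_section hX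

theorem smul {f : M → ℝ} (hf : CMDiff ∞ f) (hX : IsSmoothField X) : IsSmoothField (f • X) :=
  ContMDiff.smul_section hf hX

theorem const_smul (c : ℝ) (hX : IsSmoothField X) : IsSmoothField (c • X) :=
  ContMDiff.const_smul_section hX

theorem mlieBracket [CompleteSpace E] (hX : IsSmoothField X) (hY : IsSmoothField Y) :
    IsSmoothField (mlieBracket I X Y) := by
  have : IsManifold I (((⊤ : ℕ∞) : ℕ∞ω) + 1) M := ‹IsManifold I ∞ M›
  have : IsManifold I (minSmoothness ℝ 2) M := by
    rw [minSmoothness_of_isRCLikeNormedField]; infer_instance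
  exact ContDiff.mlieBracket_vectorField (m := ⊤) (n := ⊤) hX hY (by simp)

theorem inner [RiemannianBundle (fun x : M => TangentSpace I x)]
    [IsContMDiffRiemannianBundle I ∞ E (fun x : M => TangentSpace I x)]
    (hX : IsSmoothField X) (hY : IsSmoothField Y) :
    CMDiff ∞ (fun y => inner ℝ (X y) (Y y)) :=
  ContMDiff.inner_bundle (F := E) (E := fun x : M => TangentSpace I x) hX hY

end IsSmoothField

/-- On a Hausdorff manifold every tangent vector extends to a global smooth vector field: cut off
a local extension by a bump function. -/
theorem exists_isSmoothField [FiniteDimensional ℝ E] [T2Space M] {x : M} (v : TangentSpace I x) :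
    ∃ X : Π x : M, TangentSpace I x, IsSmoothField X ∧ X x = v := by
  obtain ⟨s, hs, hsX⟩ := exists_contMDiffOn_extend (k := ∞) I E v
  obtain ⟨u, hus, hu, hxu⟩ := mem_nhds_iff.mp hs
  obtain ⟨f, -, hf⟩ := (SmoothBumpFunction.nhds_basis_tsupport (I := I) x).mem_iff.mp
    (hu.mem_nhds hxu)
  refine ⟨(f : M → ℝ) • extend E v, ?_, ?_⟩
  · exact ContMDiffOn.smul_section_of_tsupport f.contMDiff.contMDiffOn hu hf (hsX.mono hus)
  · simp

variable [RiemannianBundle (fun x : M => TangentSpace I x)]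
  [IsContMDiffRiemannianBundle I ∞ E (fun x : M => TangentSpace I x)] [FiniteDimensional ℝ E]

/-! ### The Levi-Civita connection and covariant derivatives of endomorphism fields -/

section nabla

variable {X Y Z : Π x : M, TangentSpace I x}

theorem nabla_add (hY : IsSmoothField Y) (hZ : IsSmoothField Z) (x : M) :
    nabla X (Y + Z) x = nabla X Y x + nabla X Z x := by
  simp [nabla, leviCivita.isCovariantDerivativeOnUniv.add (hY.mdifferentiableAt x)
    (hZ.mdifferentiableAt x)]

theorem nabla_const_smul (c : ℝ) (hY : IsSmoothField Y) (x : M) :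
    nabla X (c • Y) x = c • nabla X Y x := by
  simp [nabla, leviCivita.isCovariantDerivativeOnUniv.smul_const c (hY.mdifferentiableAt x)]

theorem nabla_zero (x : M) : nabla X 0 x = 0 := by
  simp [nabla]

theorem nabla_neg (hY : IsSmoothField Y) (x : M) : nabla X (-Y) x = -nabla X Y x := by
  simpa using nabla_const_smul (X := X) (-1) hY x

theorem nabla_sub (hY : IsSmoothField Y) (hZ : IsSmoothField Z) (x : M) :
    nabla X (Y - Z) x = nabla X Y x - nabla X Z x := by
  rw [sub_eq_add_neg, nabla_add hY hZ.neg, nabla_neg hZ, sub_eq_add_neg]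

theorem nabla_smul {f : M → ℝ} (hf : CMDiff ∞ f) (hY : IsSmoothField Y) (x : M) :
    nabla X (f • Y) x = f x • nabla X Y x + d% f x (X x) • Y x := by
  simp [nabla, leviCivita.isCovariantDerivativeOnUniv.leibniz (hY.mdifferentiableAt x)
    ((hf x).mdifferentiableAt (by simp))]

theorem mvfderiv_inner (hX : IsSmoothField X) (hY : IsSmoothField Y) (hZ : IsSmoothField Z)
    (x : M) : d% (fun y => inner ℝ (Y y) (Z y)) x (X x)
      = inner ℝ (nabla X Y x) (Z x) + inner ℝ (Y x) (nabla X Z x) :=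
  leviCivita_metric (hX.mdifferentiableAt x) (hY.mdifferentiableAt x) (hZ.mdifferentiableAt x)

theorem mlieBracket_eq_nabla_sub (hX : IsSmoothField X) (hY : IsSmoothField Y) (x : M) :
    mlieBracket I X Y x = nabla X Y x - nabla Y X x := by
  have := FiniteDimensional.complete ℝ E
  exact (((CovariantDerivative.torsion_eq_zero_iff _).mp
    (leviCivita_torsion (I := I) (M := M))) (hX.mdifferentiableAt x) (hY.mdifferentiableAt x)).symm

end nabla

/-- A field of endomorphisms that preserves smooth vector fields. -/
def IsSmoothEnd (B : Π x : M, TangentSpace I x →L[ℝ] TangentSpace I x) : Prop :=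
  ∀ Y : Π x : M, TangentSpace I x, IsSmoothField Y → IsSmoothField (fun y => B y (Y y))

/-- `g(B v, w) = ε g(v, B w)`: the field of endomorphisms `B` is symmetric if `ε = 1` and skew if
`ε = -1`. -/
def HasParity (B : Π x : M, TangentSpace I x →L[ℝ] TangentSpace I x) (ε : ℝ) : Prop :=
  ∀ (x : M) (v w : TangentSpace I x), inner ℝ (B x v) w = ε * inner ℝ v (B x w)

section nablaEnd

variable {B : Π x : M, TangentSpace I x →L[ℝ] TangentSpace I x} {ε : ℝ}
  {X X' Y Z : Π x : M, TangentSpace I x}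

theorem nabla_end_apply (x : M) :
    nabla X (fun y => B y (Y y)) x = nablaEnd B X Y x + B x (nabla X Y x) := by
  simp [nablaEnd]

theorem nablaEnd_congr_left {x : M} (h : X x = X' x) : nablaEnd B X Y x = nablaEnd B X' Y x := by
  simp [nablaEnd, nabla, h]

/-- The covariant derivative of a symmetric (skew) field of endomorphisms is symmetric (skew). -/
theorem inner_nablaEnd (hB : IsSmoothEnd B) (hε : HasParity B ε) (hX : IsSmoothField X)
    (hY : IsSmoothField Y) (hZ : IsSmoothField Z) (x : M) :
    inner ℝ (nablaEnd B X Y x) (Z x) = ε * inner ℝ (Y x) (nablaEnd B X Z x) := by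
  have h1 := mvfderiv_inner hX (hB Y hY) hZ x
  have h2 := mvfderiv_inner hX hY (hB Z hZ) x
  have h3 : (fun y => inner ℝ (B y (Y y)) (Z y)) = ε • fun y => inner ℝ (Y y) (B y (Z y)) := by
    ext y; simp [hε y]
  have h4 : d% (fun y => inner ℝ (B y (Y y)) (Z y)) x (X x)
      = ε * d% (fun y => inner ℝ (Y y) (B y (Z y))) x (X x) := by
    have h5 : MDiffAt (fun y => inner ℝ (Y y) (B y (Z y))) x :=
      ((hY.inner (hB Z hZ)) x).mdifferentiableAt (by simp)
    have := mvfderiv_smul (a := fun _ : M => ε) (x := x) mdifferentiableAt_const h5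
    rw [h3]
    have h6 : (ε • fun y => inner ℝ (Y y) (B y (Z y)))
      = (fun _ : M => ε) • fun y => inner ℝ (Y y) (B y (Z y)) := rfl
    rw [h6, this, mvfderiv_const]
    simp
  rw [h1, h2] at h4
  simp only [nablaEnd, inner_sub_left, inner_sub_right, hε x] at h4 ⊢
  linarith

/-- The covariant derivative of a symmetric or skew field of endomorphisms, as a bilinear map on
each tangent space. That `(∇_X B) Y` depends only on the value of `Y` at the point follows from
`g((∇_X B) Y, Z) = ± g(Y, (∇_X B) Z)`. -/
theorem exists_covEnd [T2Space M] (hB : IsSmoothEnd B) (hε : HasParity B ε) (x : M) :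
    ∃ T : TangentSpace I x →ₗ[ℝ] TangentSpace I x →ₗ[ℝ] TangentSpace I x,
      ∀ X Y : Π x : M, TangentSpace I x, IsSmoothField X → IsSmoothField Y →
        nablaEnd B X Y x = T (X x) (Y x) := by
  choose F hF hFx using fun v : TangentSpace I x => exists_isSmoothField v
  have key : ∀ (X Y : Π x : M, TangentSpace I x) (w : TangentSpace I x), IsSmoothField X →
      IsSmoothField Y →
      inner ℝ (nablaEnd B X Y x) w = ε * inner ℝ (Y x) (nablaEnd B X (F w) x) := by
    intro X Y w hX hY
    simpa [hFx] using inner_nablaEnd hB hε hX hY (hF w) x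
  refine ⟨LinearMap.mk₂ ℝ (fun v w => nablaEnd B (F v) (F w) x) ?_ ?_ ?_ ?_, ?_⟩
  · intro v v' w
    simp [nablaEnd, nabla, hFx]; abel
  · intro c v w
    simp [nablaEnd, nabla, hFx, smul_sub]
  · intro v w w'
    refine ext_inner_right ℝ fun z => ?_
    simp [inner_add_left, key _ _ z (hF v) (hF _), hFx]; ring
  · intro c v w
    refine ext_inner_right ℝ fun z => ?_
    simp [inner_smul_left, key _ _ z (hF v) (hF _), hFx]; ring
  · intro X Y hX hY
    rw [LinearMap.mk₂_apply, nablaEnd_congr_left (X' := X) (hFx _)]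
    refine ext_inner_right ℝ fun z => ?_
    rw [key _ _ z hX hY, key _ _ z hX (hF _), hFx]

/-- The covariant derivative of a symmetric or skew field of endomorphisms at a point, as a
bilinear map: `covEnd hB hε x v w = (∇_v B) w`. -/
noncomputable def covEnd [T2Space M] (hB : IsSmoothEnd B) (hε : HasParity B ε) (x : M) :
    TangentSpace I x →ₗ[ℝ] TangentSpace I x →ₗ[ℝ] TangentSpace I x :=
  (exists_covEnd hB hε x).choose

theorem nablaEnd_eq_covEnd [T2Space M] (hB : IsSmoothEnd B) (hε : HasParity B ε) (x : M)
    (hX : IsSmoothField X) (hY : IsSmoothField Y) :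
    nablaEnd B X Y x = covEnd hB hε x (X x) (Y x) :=
  (exists_covEnd hB hε x).choose_spec X Y hX hY

theorem inner_covEnd [T2Space M] (hB : IsSmoothEnd B) (hε : HasParity B ε) (x : M)
    (u v w : TangentSpace I x) :
    inner ℝ (covEnd hB hε x u v) w = ε * inner ℝ v (covEnd hB hε x u w) := by
  obtain ⟨X, hX, rfl⟩ := exists_isSmoothField u
  obtain ⟨Y, hY, rfl⟩ := exists_isSmoothField v
  obtain ⟨Z, hZ, rfl⟩ := exists_isSmoothField w
  rw [← nablaEnd_eq_covEnd hB hε x hX hY, ← nablaEnd_eq_covEnd hB hε x hX hZ,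
    inner_nablaEnd hB hε hX hY hZ]

end nablaEnd

end AlmostContact

namespace AlmostContact

variable {E : Type*} [NormedAddCommGroup E] [NormedSpace ℝ E]
  {H : Type*} [TopologicalSpace H] {I : ModelWithCorners ℝ E H}
  {M : Type*} [TopologicalSpace M] [ChartedSpace H M] [IsManifold I ∞ M]
  [RiemannianBundle (fun x : M => TangentSpace I x)]

namespace AlmostContactMetricStructure

variable (S : AlmostContactMetricStructure I M)

/-! ### Pointwise identities of an almost contact metric structure -/

theorem phi_xi (x : M) : S.phi x (S.xi x) = 0 := by
  have h1 : S.phi x (S.phi x (S.xi x)) = 0 := by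
    rw [S.phi_phi, S.eta_xi]; simp
  -- `φ ξ = c ξ` by applying `φ²` to `φ ξ`, and `φ² ξ = 0` gives `c = 0`.
  have h2 : S.phi x (S.xi x) = S.eta x (S.phi x (S.xi x)) • S.xi x := by
    have := S.phi_phi x (S.phi x (S.xi x))
    rw [h1, map_zero] at this
    exact neg_add_eq_zero.mp this.symm
  have h3 : (S.eta x (S.phi x (S.xi x)) * S.eta x (S.phi x (S.xi x))) • S.xi x = 0 := by
    rw [mul_smul, ← h2, ← map_smul, ← h2, h1]
  have h4 := congrArg (S.eta x) h3
  rw [map_smul, S.eta_xi, map_zero, smul_eq_mul, mul_one] at h4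
  rw [h2, mul_self_eq_zero.mp h4, zero_smul]

theorem eta_phi (x : M) (v : TangentSpace I x) : S.eta x (S.phi x v) = 0 := by
  have h1 := S.phi_phi x (S.phi x v)
  rw [S.phi_phi x v, map_add, map_smul, S.phi_xi, smul_zero, add_zero, map_neg] at h1
  have h2 := congrArg (S.eta x) h1
  simpa [S.eta_xi] using h2

theorem eta_eq_inner (x : M) (v : TangentSpace I x) : S.eta x v = inner ℝ v (S.xi x) := by
  have := S.inner_phi_phi x v (S.xi x)
  rw [S.phi_xi, inner_zero_right, S.eta_xi] at this
  linarith

theorem hasParity_phi : HasParity S.phi (-1) := by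
  intro x v w
  have := S.inner_phi_phi x v (S.phi x w)
  rw [S.phi_phi, S.eta_phi, inner_add_right, inner_neg_right, inner_smul_right, ← S.eta_eq_inner,
    S.eta_phi] at this
  linarith

variable {S} in
theorem mem_D {x : M} {v : TangentSpace I x} : v ∈ S.D x ↔ S.eta x v = 0 := LinearMap.mem_ker

theorem sub_eta_smul_mem_D (x : M) (v : TangentSpace I x) :
    v - S.eta x v • S.xi x ∈ S.D x := by
  simp [mem_D, S.eta_xi]

theorem phi_mem_D (x : M) (v : TangentSpace I x) : S.phi x v ∈ S.D x := mem_D.mpr (S.eta_phi x v)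

variable {S} in
/-- A vector orthogonal to `D` is a multiple of `ξ`. -/
theorem eq_eta_smul_xi {x : M} {t : TangentSpace I x} (ht : ∀ w ∈ S.D x, inner ℝ t w = 0) :
    t = S.eta x t • S.xi x := by
  have h1 := S.sub_eta_smul_mem_D x t
  have h2 := ht _ h1
  rw [mem_D, S.eta_eq_inner, real_inner_comm] at h1
  have h3 : inner ℝ (t - S.eta x t • S.xi x) (t - S.eta x t • S.xi x) = 0 := by
    conv_lhs => rw [inner_sub_left]
    rw [h2, inner_smul_left, h1, mul_zero, sub_zero]
  exact sub_eq_zero.mp (inner_self_eq_zero.mp h3)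

/-- `D` is nonzero as soon as `dim M ≥ 2`, because `D` is the kernel of a linear form. -/
theorem exists_mem_D_ne_zero [FiniteDimensional ℝ E] (hE : 2 ≤ Module.finrank ℝ E) (x : M) :
    ∃ v ∈ S.D x, v ≠ 0 := by
  have : FiniteDimensional ℝ (TangentSpace I x) := ‹FiniteDimensional ℝ E›
  have h1 := (S.eta x : TangentSpace I x →ₗ[ℝ] ℝ).finrank_range_add_finrank_ker
  have h2 : Module.finrank ℝ (TangentSpace I x) = Module.finrank ℝ E := rfl
  have h3 := Submodule.finrank_le (LinearMap.range (S.eta x : TangentSpace I x →ₗ[ℝ] ℝ))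
  rw [Module.finrank_self] at h3
  have h4 : S.D x ≠ ⊥ := by
    intro h
    rw [D] at h
    rw [h, finrank_bot] at h1
    omega
  exact (S.D x).ne_bot_iff.mp h4

theorem isSmoothEnd_phi : IsSmoothEnd S.phi := fun _ hY x =>
  ContMDiffAt.clm_bundle_apply (b := fun y : M => y) (S.contMDiff_phi x) (hY x)

variable [IsContMDiffRiemannianBundle I ∞ E (fun x : M => TangentSpace I x)]

theorem contMDiff_eta_apply {Y : Π x : M, TangentSpace I x} (hY : IsSmoothField Y) :
    CMDiff ∞ (fun y => S.eta y (Y y)) := by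
  simp only [S.eta_eq_inner]
  exact hY.inner S.contMDiff_xi

variable [FiniteDimensional ℝ E]

theorem isSmoothEnd_h : IsSmoothEnd S.h := by
  have := FiniteDimensional.complete ℝ E
  intro Y hY
  have h1 : (fun y => S.h y (Y y)) = (1 / 2 : ℝ) •
      (mlieBracket I S.xi (fun y => S.phi y (Y y))
        - fun y => S.phi y (mlieBracket I S.xi Y y)) := by
    ext y
    rw [S.h_apply (hY.mdifferentiableAt y)]
    rfl
  rw [h1]
  exact ((S.contMDiff_xi.mlieBracket (S.isSmoothEnd_phi Y hY)).sub
    (S.isSmoothEnd_phi _ (S.contMDiff_xi.mlieBracket hY))).const_smul _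

/-! ### The covariant derivatives of `ξ` and `φ` -/

/-- The endomorphism `v ↦ ∇_v ξ`. -/
noncomputable def nablaXi (x : M) : TangentSpace I x →L[ℝ] TangentSpace I x := leviCivita S.xi x

theorem mvfderiv_eta {X Y : Π x : M, TangentSpace I x} (hX : IsSmoothField X)
    (hY : IsSmoothField Y) (x : M) :
    d% (fun y => S.eta y (Y y)) x (X x)
      = S.eta x (nabla X Y x) + inner ℝ (Y x) (S.nablaXi x (X x)) := by
  simp only [S.eta_eq_inner]
  exact mvfderiv_inner hX hY S.contMDiff_xi x

variable [T2Space M]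

variable {S} in
theorem exists_isSmoothField_D {x : M} {v : TangentSpace I x} (hv : v ∈ S.D x) :
    ∃ X : Π x : M, TangentSpace I x, IsSmoothField X ∧ (∀ y, X y ∈ S.D y) ∧ X x = v := by
  obtain ⟨X, hX, rfl⟩ := exists_isSmoothField v
  refine ⟨X - (fun y => S.eta y (X y)) • S.xi,
    hX.sub (S.contMDiff_xi.smul (S.contMDiff_eta_apply hX)),
    fun y => S.sub_eta_smul_mem_D y (X y), ?_⟩
  simp [mem_D.mp hv]

theorem eta_nablaXi (x : M) (v : TangentSpace I x) : S.eta x (S.nablaXi x v) = 0 := by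
  obtain ⟨X, hX, rfl⟩ := exists_isSmoothField v
  have h1 := S.mvfderiv_eta hX S.contMDiff_xi x
  simp only [S.eta_xi, mvfderiv_const] at h1
  rw [real_inner_comm, ← S.eta_eq_inner] at h1
  have h2 : nabla X S.xi x = S.nablaXi x (X x) := rfl
  rw [h2] at h1
  have h3 : (0 : ℝ) = S.eta x (S.nablaXi x (X x)) + S.eta x (S.nablaXi x (X x)) := h1
  linarith

/-- The covariant derivative of `φ`: `covPhi x v w = (∇_v φ) w`. -/
noncomputable def covPhi (x : M) : TangentSpace I x →ₗ[ℝ] TangentSpace I x →ₗ[ℝ] TangentSpace I x :=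
  covEnd S.isSmoothEnd_phi S.hasParity_phi x

theorem nablaEnd_phi {X Y : Π x : M, TangentSpace I x} (hX : IsSmoothField X)
    (hY : IsSmoothField Y) (x : M) : nablaEnd S.phi X Y x = S.covPhi x (X x) (Y x) :=
  nablaEnd_eq_covEnd _ _ x hX hY

theorem inner_covPhi (x : M) (u v w : TangentSpace I x) :
    inner ℝ (S.covPhi x u v) w = -inner ℝ v (S.covPhi x u w) := by
  rw [covPhi, inner_covEnd]; ring

theorem covPhi_xi (x : M) (u : TangentSpace I x) :
    S.covPhi x u (S.xi x) = -S.phi x (S.nablaXi x u) := by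
  obtain ⟨X, hX, rfl⟩ := exists_isSmoothField u
  rw [← S.nablaEnd_phi hX S.contMDiff_xi, nablaEnd]
  have h1 : (fun y => S.phi y (S.xi y)) = 0 := by ext y; simp [S.phi_xi]
  rw [h1, nabla_zero, zero_sub]
  rfl

/-- The covariant derivative of `φ² = -1 + η ⊗ ξ`. -/
theorem covPhi_phi (x : M) (u v : TangentSpace I x) :
    S.covPhi x u (S.phi x v) + S.phi x (S.covPhi x u v)
      = inner ℝ v (S.nablaXi x u) • S.xi x + S.eta x v • S.nablaXi x u := by
  obtain ⟨X, hX, rfl⟩ := exists_isSmoothField u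
  obtain ⟨Y, hY, rfl⟩ := exists_isSmoothField v
  rw [← S.nablaEnd_phi hX hY,
    ← S.nablaEnd_phi (Y := fun y => S.phi y (Y y)) hX (S.isSmoothEnd_phi Y hY)]
  simp only [nablaEnd, S.phi_phi]
  have h1 : (fun y => -Y y + S.eta y (Y y) • S.xi y)
      = -Y + (fun y => S.eta y (Y y)) • S.xi := rfl
  have hη := S.contMDiff_eta_apply hY
  rw [h1, nabla_add hY.neg (S.contMDiff_xi.smul hη), nabla_neg hY,
    nabla_smul hη S.contMDiff_xi, S.mvfderiv_eta hX hY, map_sub, S.phi_phi]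
  have h2 : nabla X S.xi x = S.nablaXi x (X x) := rfl
  rw [h2]
  module

/-- `dΦ` is the cyclic sum of `g((∇_X φ) Y, Z)`, because `∇` has no torsion. -/
theorem dTwoForm_Phi {X Y Z : Π x : M, TangentSpace I x} (hX : IsSmoothField X)
    (hY : IsSmoothField Y) (hZ : IsSmoothField Z) (x : M) :
    dTwoForm S.Phi X Y Z x = inner ℝ (S.covPhi x (X x) (Y x)) (Z x)
      + inner ℝ (S.covPhi x (Y x) (Z x)) (X x) + inner ℝ (S.covPhi x (Z x) (X x)) (Y x) := by
  simp only [dTwoForm, Phi]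
  rw [mvfderiv_inner hX (S.isSmoothEnd_phi Y hY) hZ, mvfderiv_inner hY (S.isSmoothEnd_phi Z hZ) hX,
    mvfderiv_inner hZ (S.isSmoothEnd_phi X hX) hY, nabla_end_apply, nabla_end_apply,
    nabla_end_apply, S.nablaEnd_phi hX hY, S.nablaEnd_phi hY hZ, S.nablaEnd_phi hZ hX,
    mlieBracket_eq_nabla_sub hX hY, mlieBracket_eq_nabla_sub hY hZ, mlieBracket_eq_nabla_sub hZ hX]
  simp only [map_sub, inner_sub_left, inner_add_left]
  have h1 := S.hasParity_phi x (Z x) (nabla Y X x)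
  have h2 := S.hasParity_phi x (X x) (nabla Z Y x)
  have h3 := S.hasParity_phi x (Y x) (nabla X Z x)
  rw [real_inner_comm (S.phi x _) (Z x)] at h1
  rw [real_inner_comm (S.phi x _) (X x)] at h2
  rw [real_inner_comm (S.phi x _) (Y x)] at h3
  linarith

section AlmostCosymplectic

variable {S} {α : ℝ}

/-- `dη = 0` says that `∇ξ` is symmetric. -/
theorem nablaXi_symm (hS : S.IsAlmostCosymplectic α) (x : M) (v w : TangentSpace I x) :
    inner ℝ (S.nablaXi x v) w = inner ℝ v (S.nablaXi x w) := by
  obtain ⟨X, hX, rfl⟩ := exists_isSmoothField v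
  obtain ⟨Y, hY, rfl⟩ := exists_isSmoothField w
  have h1 := hS.d_eta X Y hX hY x
  simp only [dOneForm] at h1
  rw [S.mvfderiv_eta hX hY, S.mvfderiv_eta hY hX, mlieBracket_eq_nabla_sub hX hY, map_sub] at h1
  rw [real_inner_comm]
  linarith

theorem nablaXi_xi (hS : S.IsAlmostCosymplectic α) (x : M) : S.nablaXi x (S.xi x) = 0 := by
  refine ext_inner_right ℝ fun w => ?_
  rw [nablaXi_symm hS, real_inner_comm, ← S.eta_eq_inner, S.eta_nablaXi, inner_zero_left]

theorem covPhi_cyclic (hS : S.IsAlmostCosymplectic α) (x : M) (u v w : TangentSpace I x) :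
    inner ℝ (S.covPhi x u v) w + inner ℝ (S.covPhi x v w) u + inner ℝ (S.covPhi x w u) v
      = 2 * α * (S.eta x u * inner ℝ (S.phi x v) w + S.eta x v * inner ℝ (S.phi x w) u
        + S.eta x w * inner ℝ (S.phi x u) v) := by
  obtain ⟨X, hX, rfl⟩ := exists_isSmoothField u
  obtain ⟨Y, hY, rfl⟩ := exists_isSmoothField v
  obtain ⟨Z, hZ, rfl⟩ := exists_isSmoothField w
  rw [← S.dTwoForm_Phi hX hY hZ, hS.d_Phi X Y Z hX hY hZ]
  rfl

/-- The contraction of `dΦ = 2 α η ∧ Φ` with `ξ`. -/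
theorem covPhi_xi_left_add (hS : S.IsAlmostCosymplectic α) (x : M) (v : TangentSpace I x) :
    S.covPhi x (S.xi x) v + S.phi x (S.nablaXi x v) + S.nablaXi x (S.phi x v)
      = (2 * α) • S.phi x v := by
  refine ext_inner_right ℝ fun w => ?_
  have h1 := covPhi_cyclic hS x (S.xi x) v w
  rw [S.covPhi_xi, S.inner_covPhi x v w, S.covPhi_xi, S.phi_xi, ← S.eta_eq_inner, S.eta_phi,
    S.eta_xi] at h1
  have h2 := S.hasParity_phi x (S.nablaXi x w) v
  rw [nablaXi_symm hS] at h2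
  have h3 := real_inner_comm w (S.phi x (S.nablaXi x v))
  have h4 := real_inner_comm w (S.nablaXi x (S.phi x v))
  simp only [inner_neg_left, inner_neg_right, inner_add_left, inner_smul_left, inner_zero_left]
    at h1 ⊢
  simp only [conj_trivial]
  linarith

theorem phi_nablaXi_add (hS : S.IsAlmostCosymplectic α) (x : M) (v : TangentSpace I x) :
    S.phi x (S.nablaXi x v) + S.nablaXi x (S.phi x v) = (2 * α) • S.phi x v := by
  -- `φ (∇_ξ φ) + (∇_ξ φ) φ = 0` with `∇_ξ φ = 2αφ - φA - Aφ` gives `φAφ = A + 2αφ²`,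
  -- where `A = ∇ξ`.
  have h1 := S.covPhi_phi x (S.xi x) v
  rw [nablaXi_xi hS, inner_zero_right, zero_smul, smul_zero, add_zero] at h1
  have h2 := covPhi_xi_left_add hS x v
  have h3 := covPhi_xi_left_add hS x (S.phi x v)
  rw [S.phi_phi x v, map_add, map_neg, map_smul, nablaXi_xi hS, smul_zero, add_zero] at h3
  have h2' := congrArg (S.phi x) h2
  simp only [map_add, map_smul, S.phi_phi, S.eta_nablaXi, zero_smul, add_zero] at h2'
  have h4 : S.phi x (S.nablaXi x (S.phi x v)) = S.nablaXi x v
      + (2 * α) • (-v + S.eta x v • S.xi x) := by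
    have h5 : (2 : ℝ) • S.phi x (S.nablaXi x (S.phi x v)) = (2 : ℝ) • (S.nablaXi x v
      + (2 * α) • (-v + S.eta x v • S.xi x)) := by
      linear_combination (norm := module) h2' + h3 - h1
    exact smul_right_injective _ (two_ne_zero) h5
  have h6 := congrArg (S.phi x) h4
  simp only [map_add, map_smul, map_neg, S.phi_phi, S.eta_nablaXi, S.phi_xi, zero_smul, smul_zero,
    add_zero] at h6
  linear_combination (norm := module) -h6

theorem covPhi_xi_left (hS : S.IsAlmostCosymplectic α) (x : M) (v : TangentSpace I x) :
    S.covPhi x (S.xi x) v = 0 := by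
  have h1 := covPhi_xi_left_add hS x v
  rw [add_assoc, phi_nablaXi_add hS] at h1
  simpa using h1

/-! ### The tensor `h` -/

theorem h_eq (hS : S.IsAlmostCosymplectic α) (x : M) (v : TangentSpace I x) :
    S.h x v = S.phi x (S.nablaXi x v) - α • S.phi x v := by
  obtain ⟨X, hX, rfl⟩ := exists_isSmoothField v
  have hφX := S.isSmoothEnd_phi X hX
  rw [S.h_apply (hX.mdifferentiableAt x), lieXiPhi,
    mlieBracket_eq_nabla_sub S.contMDiff_xi hφX, mlieBracket_eq_nabla_sub S.contMDiff_xi hX,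
    nabla_end_apply, S.nablaEnd_phi S.contMDiff_xi hX, covPhi_xi_left hS]
  have h1 : nabla X S.xi x = S.nablaXi x (X x) := rfl
  have h2 : nabla (fun y => S.phi y (X y)) S.xi x = S.nablaXi x (S.phi x (X x)) := rfl
  rw [h1, h2, map_sub]
  have h3 := phi_nablaXi_add hS x (X x)
  linear_combination (norm := module) (-(1 / 2) : ℝ) • h3

theorem h_xi (hS : S.IsAlmostCosymplectic α) (x : M) : S.h x (S.xi x) = 0 := by
  rw [h_eq hS, nablaXi_xi hS, S.phi_xi, map_zero, smul_zero, sub_zero]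

theorem eta_h (hS : S.IsAlmostCosymplectic α) (x : M) (v : TangentSpace I x) :
    S.eta x (S.h x v) = 0 := by
  simp [h_eq hS, S.eta_phi]

theorem nablaXi_eq (hS : S.IsAlmostCosymplectic α) (x : M) (v : TangentSpace I x) :
    S.nablaXi x v = α • (v - S.eta x v • S.xi x) - S.phi x (S.h x v) := by
  simp only [h_eq hS, map_sub, map_smul, S.phi_phi, S.eta_nablaXi]
  module

theorem h_phi (hS : S.IsAlmostCosymplectic α) (x : M) (v : TangentSpace I x) :
    S.h x (S.phi x v) = -S.phi x (S.h x v) := by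
  have h1 := congrArg (S.phi x) (phi_nablaXi_add hS x v)
  simp only [h_eq hS, map_sub, map_smul, map_add, S.phi_phi, S.eta_nablaXi] at h1 ⊢
  linear_combination (norm := module) h1

theorem hasParity_h (hS : S.IsAlmostCosymplectic α) : HasParity S.h 1 := by
  intro x v w
  have h1 := S.hasParity_phi x (S.nablaXi x v) w
  rw [nablaXi_symm hS] at h1
  have h2 := congrArg (inner ℝ v) (phi_nablaXi_add hS x w)
  rw [inner_add_right, inner_smul_right] at h2
  have h3 := S.hasParity_phi x v w
  simp only [h_eq hS, inner_sub_left, inner_sub_right, inner_smul_left, inner_smul_right,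
    conj_trivial]
  linear_combination h1 - h2 - α * h3

theorem phi_h_symm (hS : S.IsAlmostCosymplectic α) (x : M) (v w : TangentSpace I x) :
    inner ℝ (S.phi x (S.h x v)) w = inner ℝ v (S.phi x (S.h x w)) := by
  rw [S.hasParity_phi, hasParity_h hS, h_phi hS, inner_neg_right]
  ring

theorem phi_eigenD (hS : S.IsAlmostCosymplectic α) {x : M} {c : ℝ} {v : TangentSpace I x}
    (hv : v ∈ S.eigenD x c) : S.phi x v ∈ S.eigenD x (-c) := by
  have h1 : S.h x v = c • v := Module.End.mem_eigenspace_iff.mp hv.2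
  refine ⟨S.phi_mem_D x v, Module.End.mem_eigenspace_iff.mpr ?_⟩
  change S.h x (S.phi x v) = -c • S.phi x v
  rw [h_phi hS, h1, map_smul, neg_smul]

/-! ### The covariant derivative of `h` -/

/-- The covariant derivative of `h`: `covH hS x v w = (∇_v h) w`. -/
noncomputable def covH (hS : S.IsAlmostCosymplectic α) (x : M) :
    TangentSpace I x →ₗ[ℝ] TangentSpace I x →ₗ[ℝ] TangentSpace I x :=
  covEnd S.isSmoothEnd_h (hasParity_h hS) x

theorem nablaEnd_h (hS : S.IsAlmostCosymplectic α) {X Y : Π x : M, TangentSpace I x}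
    (hX : IsSmoothField X) (hY : IsSmoothField Y) (x : M) :
    nablaEnd S.h X Y x = covH hS x (X x) (Y x) :=
  nablaEnd_eq_covEnd _ _ x hX hY

theorem covH_xi (hS : S.IsAlmostCosymplectic α) (x : M) (u : TangentSpace I x) :
    covH hS x u (S.xi x) = -S.h x (S.nablaXi x u) := by
  obtain ⟨X, hX, rfl⟩ := exists_isSmoothField u
  rw [← nablaEnd_h hS hX S.contMDiff_xi, nablaEnd]
  have h1 : (fun y => S.h y (S.xi y)) = 0 := by ext y; simp [h_xi hS]
  rw [h1, nabla_zero, zero_sub]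
  rfl

/-- The covariant derivative of `φ h + h φ = 0`. -/
theorem covPhi_h_add (hS : S.IsAlmostCosymplectic α) (x : M) (u v : TangentSpace I x) :
    S.covPhi x u (S.h x v) + S.phi x (covH hS x u v) + covH hS x u (S.phi x v)
      + S.h x (S.covPhi x u v) = 0 := by
  obtain ⟨X, hX, rfl⟩ := exists_isSmoothField u
  obtain ⟨Y, hY, rfl⟩ := exists_isSmoothField v
  have hφY := S.isSmoothEnd_phi Y hY
  have hhY := S.isSmoothEnd_h Y hY
  rw [← S.nablaEnd_phi hX hY, ← S.nablaEnd_phi (Y := fun y => S.h y (Y y)) hX hhY,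
    ← nablaEnd_h hS hX hY, ← nablaEnd_h hS (Y := fun y => S.phi y (Y y)) hX hφY]
  simp only [nablaEnd, h_phi hS, map_sub]
  have h1 : (fun y => -S.phi y (S.h y (Y y))) = -fun y => S.phi y (S.h y (Y y)) := rfl
  rw [h1, nabla_neg (S.isSmoothEnd_phi _ hhY)]
  abel

/-- `η`-parallelism together with `∇_ξ h = 0`: `(∇_u h) v` is a multiple of `ξ` for `v ∈ D`. -/
theorem inner_covH_eq_zero (hS : S.IsAlmostCosymplectic α)
    (hxi : ∀ Y : Π x : M, TangentSpace I x, IsSmoothField Y → ∀ x, nablaEnd S.h S.xi Y x = 0)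
    (hpar : S.IsEtaParallel S.h) {x : M} (u : TangentSpace I x) {v w : TangentSpace I x}
    (hv : v ∈ S.D x) (hw : w ∈ S.D x) : inner ℝ (covH hS x u v) w = 0 := by
  have h1 : ∀ u' ∈ S.D x, inner ℝ (covH hS x u' v) w = 0 := by
    intro u' hu'
    obtain ⟨X, hX, hXD, rfl⟩ := exists_isSmoothField_D hu'
    obtain ⟨Y, hY, hYD, rfl⟩ := exists_isSmoothField_D hv
    obtain ⟨Z, hZ, hZD, rfl⟩ := exists_isSmoothField_D hw
    rw [← nablaEnd_h hS hX hY]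
    exact hpar X Y Z hX hY hZ hXD hYD hZD x
  have h2 : covH hS x (S.xi x) v = 0 := by
    obtain ⟨Y, hY, rfl⟩ := exists_isSmoothField v
    rw [← nablaEnd_h hS S.contMDiff_xi hY, hxi Y hY x]
  have h3 := h1 _ (S.sub_eta_smul_mem_D x u)
  rw [map_sub, map_smul, LinearMap.sub_apply, LinearMap.smul_apply, h2, smul_zero, sub_zero] at h3
  exact h3

theorem phi_covH_eq_zero (hS : S.IsAlmostCosymplectic α)
    (hxi : ∀ Y : Π x : M, TangentSpace I x, IsSmoothField Y → ∀ x, nablaEnd S.h S.xi Y x = 0)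
    (hpar : S.IsEtaParallel S.h) {x : M} (u : TangentSpace I x) {v : TangentSpace I x}
    (hv : v ∈ S.D x) : S.phi x (covH hS x u v) = 0 := by
  rw [eq_eta_smul_xi fun w hw => inner_covH_eq_zero hS hxi hpar u hv hw, map_smul, S.phi_xi,
    smul_zero]

/-! ### The spectrum of `h` -/

theorem h_h (hS : S.IsAlmostCosymplectic α) {x : M} {c : ℝ}
    (hspec : S.eigenD x c ⊔ S.eigenD x (-c) = S.D x) (v : TangentSpace I x) :
    S.h x (S.h x v) = c ^ 2 • (v - S.eta x v • S.xi x) := by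
  have h1 := S.sub_eta_smul_mem_D x v
  have h2 : S.h x v = S.h x (v - S.eta x v • S.xi x) := by
    rw [map_sub, map_smul, h_xi hS, smul_zero, sub_zero]
  rw [h2]
  rw [← hspec] at h1
  obtain ⟨a, ha, b, hb, hab⟩ := Submodule.mem_sup.mp h1
  have ha' : S.h x a = c • a := Module.End.mem_eigenspace_iff.mp ha.2
  have hb' : S.h x b = -c • b := Module.End.mem_eigenspace_iff.mp hb.2
  rw [← hab]
  simp only [map_add, map_smul, ha', hb']
  module

theorem inner_h_h (hS : S.IsAlmostCosymplectic α) {x : M} {c : ℝ}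
    (hspec : S.eigenD x c ⊔ S.eigenD x (-c) = S.D x) (u : TangentSpace I x)
    {v : TangentSpace I x} (hv : v ∈ S.D x) :
    inner ℝ (S.h x u) (S.h x v) = c ^ 2 * inner ℝ u v := by
  rw [hasParity_h hS, h_h hS hspec, mem_D.mp hv, zero_smul, sub_zero, inner_smul_right, one_mul]

/-! ### The leaves of `D` are Kähler where `h ≠ 0` -/

/-- Modulo `ξ`, `∇_u φ` anticommutes with `h` on `D`. -/
theorem inner_covPhi_h (hS : S.IsAlmostCosymplectic α)
    (hxi : ∀ Y : Π x : M, TangentSpace I x, IsSmoothField Y → ∀ x, nablaEnd S.h S.xi Y x = 0)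
    (hpar : S.IsEtaParallel S.h) {x : M} (u : TangentSpace I x) {v w : TangentSpace I x}
    (hv : v ∈ S.D x) (hw : w ∈ S.D x) :
    inner ℝ (S.covPhi x u (S.h x v)) w = -inner ℝ (S.covPhi x u v) (S.h x w) := by
  have h1 := congrArg (fun t => inner ℝ t w) (covPhi_h_add hS x u v)
  simp only [phi_covH_eq_zero hS hxi hpar u hv, inner_add_left, inner_zero_left,
    inner_covH_eq_zero hS hxi hpar u (S.phi_mem_D x v) hw, hasParity_h hS x (S.covPhi x u v)] at h1
  linarith

/-- The form `g((∇_u φ) v, φ w)` on one eigenspace `D(c)`, `c ≠ 0`, is symmetric in `u`, `v`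
because `dΦ` vanishes on `D` and `∇_u φ` exchanges `D(c)` and `D(-c)`; it is skew in `v`, `w`
because `φ² = -1` on `D`. Hence it vanishes. -/
theorem inner_covPhi_phi_eigenD (hS : S.IsAlmostCosymplectic α)
    (hxi : ∀ Y : Π x : M, TangentSpace I x, IsSmoothField Y → ∀ x, nablaEnd S.h S.xi Y x = 0)
    (hpar : S.IsEtaParallel S.h) {x : M} {c : ℝ} (hc : c ≠ 0) {u v w : TangentSpace I x}
    (hu : u ∈ S.eigenD x c) (hv : v ∈ S.eigenD x c) (hw : w ∈ S.eigenD x c) :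
    inner ℝ (S.covPhi x u v) (S.phi x w) = 0 := by
  have symm : ∀ {u v w : TangentSpace I x}, u ∈ S.eigenD x c → v ∈ S.eigenD x c →
      w ∈ S.eigenD x c →
      inner ℝ (S.covPhi x u v) (S.phi x w) = inner ℝ (S.covPhi x v u) (S.phi x w) := by
    intro u v w hu hv hw
    have h1 := covPhi_cyclic hS x u v (S.phi x w)
    rw [mem_D.mp hu.1, mem_D.mp hv.1, S.eta_phi, S.inner_covPhi x v (S.phi x w) u,
      real_inner_comm] at h1
    have h2 := inner_covPhi_h hS hxi hpar (S.phi x w) hu.1 hv.1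
    have hu' : S.h x u = c • u := Module.End.mem_eigenspace_iff.mp hu.2
    have hv' : S.h x v = c • v := Module.End.mem_eigenspace_iff.mp hv.2
    rw [hu', hv', map_smul, inner_smul_left, inner_smul_right, conj_trivial] at h2
    have h3 : inner ℝ (S.covPhi x (S.phi x w) u) v = 0 := by
      have : c * inner ℝ (S.covPhi x (S.phi x w) u) v = 0 := by linarith
      exact (mul_eq_zero.mp this).resolve_left hc
    have h4 := real_inner_comm (S.phi x w) (S.covPhi x u v)
    have h5 := real_inner_comm (S.phi x w) (S.covPhi x v u)
    linarith
  have skew : ∀ {u v w : TangentSpace I x}, u ∈ S.eigenD x c → v ∈ S.eigenD x c →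
      w ∈ S.eigenD x c →
      inner ℝ (S.covPhi x u v) (S.phi x w) = -inner ℝ (S.covPhi x u w) (S.phi x v) := by
    intro u v w hu hv hw
    have h1 := congrArg (inner ℝ v) (S.covPhi_phi x u w)
    rw [mem_D.mp hw.1, zero_smul, add_zero, inner_smul_right, ← S.eta_eq_inner, mem_D.mp hv.1,
      mul_zero, inner_add_right] at h1
    have h2 := S.hasParity_phi x v (S.covPhi x u w)
    rw [S.inner_covPhi, real_inner_comm (S.phi x v)]
    linarith
  have h1 := symm hu hv hw
  have h2 := skew hv hu hw
  have h3 := symm hv hw hu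
  have h4 := skew hw hv hu
  have h5 := symm hw hu hv
  have h6 := skew hu hw hv
  linarith

/-- For `u` in one of the eigenspaces of `h` on `D`, `c ≠ 0`, the `D`-component of `(∇_u φ) v` vanishes
for all `v ∈ D`: `∇_u φ` has no component within an eigenspace, and the component between the two
vanishes by `inner_covPhi_phi_eigenD`. -/
theorem inner_covPhi_eigenD (hS : S.IsAlmostCosymplectic α)
    (hxi : ∀ Y : Π x : M, TangentSpace I x, IsSmoothField Y → ∀ x, nablaEnd S.h S.xi Y x = 0)
    (hpar : S.IsEtaParallel S.h) {x : M} {c : ℝ} (hc : c ≠ 0)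
    (hspec : S.eigenD x c ⊔ S.eigenD x (-c) = S.D x) {u v w : TangentSpace I x}
    (hu : u ∈ S.eigenD x c) (hv : v ∈ S.D x) (hw : w ∈ S.D x) :
    inner ℝ (S.covPhi x u v) w = 0 := by
  have same : ∀ (s : ℝ), s ≠ 0 → ∀ a ∈ S.eigenD x s, ∀ b ∈ S.eigenD x s,
      inner ℝ (S.covPhi x u a) b = 0 := by
    intro s hs a ha b hb
    have h2 := inner_covPhi_h hS hxi hpar u ha.1 hb.1
    have ha' : S.h x a = s • a := Module.End.mem_eigenspace_iff.mp ha.2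
    have hb' : S.h x b = s • b := Module.End.mem_eigenspace_iff.mp hb.2
    rw [ha', hb', map_smul, inner_smul_left, inner_smul_right, conj_trivial] at h2
    have : s * inner ℝ (S.covPhi x u a) b = 0 := by linarith
    exact (mul_eq_zero.mp this).resolve_left hs
  have mixed : ∀ a ∈ S.eigenD x c, ∀ b ∈ S.eigenD x (-c), inner ℝ (S.covPhi x u a) b = 0 := by
    intro a ha b hb
    have hφb : S.phi x b ∈ S.eigenD x c := by simpa using phi_eigenD hS hb
    have h1 := inner_covPhi_phi_eigenD hS hxi hpar hc hu ha hφb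
    rw [S.phi_phi, mem_D.mp hb.1, zero_smul, add_zero, inner_neg_right] at h1
    linarith
  rw [← hspec] at hv hw
  obtain ⟨a, ha, b, hb, rfl⟩ := Submodule.mem_sup.mp hv
  obtain ⟨a', ha', b', hb', rfl⟩ := Submodule.mem_sup.mp hw
  have h1 : inner ℝ (S.covPhi x u b) a' = 0 := by
    rw [S.inner_covPhi, real_inner_comm, mixed a' ha' b hb, neg_zero]
  rw [map_add, inner_add_left, inner_add_right, inner_add_right, same c hc a ha a' ha',
    mixed a ha b' hb', h1, same (-c) (neg_ne_zero.mpr hc) b hb b' hb']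
  simp

/-- `(∇_u φ) h v` is a multiple of `ξ` for `u, v ∈ D`. Where `λ ≠ 0` already `(∇_u φ) v` is, so the
leaves of `D` are Kähler there; where `λ = 0`, `h` vanishes. -/
theorem inner_covPhi_h_eq_zero (hS : S.IsAlmostCosymplectic α)
    (hxi : ∀ Y : Π x : M, TangentSpace I x, IsSmoothField Y → ∀ x, nablaEnd S.h S.xi Y x = 0)
    (hpar : S.IsEtaParallel S.h) {x : M} {c : ℝ}
    (hspec : S.eigenD x c ⊔ S.eigenD x (-c) = S.D x) {u v w : TangentSpace I x}
    (hu : u ∈ S.D x) (hv : v ∈ S.D x) (hw : w ∈ S.D x) :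
    inner ℝ (S.covPhi x u (S.h x v)) w = 0 := by
  by_cases hc : c = 0
  · have h1 := inner_h_h hS hspec v hv
    rw [hc, zero_pow two_ne_zero, zero_mul, inner_self_eq_zero] at h1
    rw [h1, map_zero, inner_zero_left]
  · have hspec' : S.eigenD x (-c) ⊔ S.eigenD x (- -c) = S.D x := by
      rw [neg_neg, sup_comm, hspec]
    have hu' := hu
    rw [← hspec] at hu'
    obtain ⟨a, ha, b, hb, rfl⟩ := Submodule.mem_sup.mp hu'
    have hhv : S.h x v ∈ S.D x := mem_D.mpr (eta_h hS x v)
    rw [map_add, LinearMap.add_apply, inner_add_left,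
      inner_covPhi_eigenD hS hxi hpar hc hspec ha hhv hw,
      inner_covPhi_eigenD hS hxi hpar (neg_ne_zero.mpr hc) hspec' hb hhv hw, add_zero]

/-! ### The curvature `R(X, Y) ξ` -/

/-- `R(X, Y) ξ = (∇_X A) Y - (∇_Y A) X` for `A = ∇ξ = α (1 - η ⊗ ξ) - φ h`. -/
theorem curvature_xi_eq (hS : S.IsAlmostCosymplectic α) {X Y : Π x : M, TangentSpace I x}
    (hX : IsSmoothField X) (hY : IsSmoothField Y) (x : M) :
    curvature X Y S.xi x = α • (S.eta x (X x) • S.nablaXi x (Y x)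
        - S.eta x (Y x) • S.nablaXi x (X x))
      - (S.covPhi x (X x) (S.h x (Y x)) + S.phi x (covH hS x (X x) (Y x)))
      + (S.covPhi x (Y x) (S.h x (X x)) + S.phi x (covH hS x (Y x) (X x))) := by
  have h1 : ∀ {X Y : Π x : M, TangentSpace I x}, IsSmoothField X → IsSmoothField Y →
      nabla X (nabla Y S.xi) x = S.nablaXi x (nabla X Y x)
        - α • (inner ℝ (Y x) (S.nablaXi x (X x)) • S.xi x + S.eta x (Y x) • S.nablaXi x (X x))
        - (S.covPhi x (X x) (S.h x (Y x)) + S.phi x (covH hS x (X x) (Y x))) := by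
    intro X Y hX hY
    have hη := S.contMDiff_eta_apply hY
    have hhY := S.isSmoothEnd_h Y hY
    have h2 : nabla Y S.xi = α • (Y - (fun y => S.eta y (Y y)) • S.xi)
        - fun y => S.phi y (S.h y (Y y)) := by
      ext1 y
      exact nablaXi_eq hS y (Y y)
    have h3 : nabla X S.xi x = S.nablaXi x (X x) := rfl
    rw [h2, nabla_sub ((hY.sub (S.contMDiff_xi.smul hη)).const_smul α) (S.isSmoothEnd_phi _ hhY),
      nabla_const_smul _ (hY.sub (S.contMDiff_xi.smul hη)),
      nabla_sub hY (S.contMDiff_xi.smul hη), nabla_smul hη S.contMDiff_xi, h3,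
      S.mvfderiv_eta hX hY, nabla_end_apply (Y := fun y => S.h y (Y y)), nabla_end_apply,
      S.nablaEnd_phi (Y := fun y => S.h y (Y y)) hX hhY, nablaEnd_h hS hX hY,
      nablaXi_eq hS x (nabla X Y x), map_add]
    module
  have h4 : nabla (mlieBracket I X Y) S.xi x = S.nablaXi x (mlieBracket I X Y x) := rfl
  rw [curvature, h1 hX hY, h1 hY hX, h4, mlieBracket_eq_nabla_sub hX hY, map_sub,
    ← nablaXi_symm hS x (Y x), real_inner_comm (X x)]
  module

theorem curvature_xi_eq_kappa (hS : S.IsAlmostCosymplectic α)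
    (hxi : ∀ Y : Π x : M, TangentSpace I x, IsSmoothField Y → ∀ x, nablaEnd S.h S.xi Y x = 0)
    (hpar : S.IsEtaParallel S.h) {x : M} {c : ℝ}
    (hspec : S.eigenD x c ⊔ S.eigenD x (-c) = S.D x) {X Y : Π x : M, TangentSpace I x}
    (hX : IsSmoothField X) (hY : IsSmoothField Y) :
    curvature X Y S.xi x
      = S.eta x (Y x) • (-(α ^ 2 + c ^ 2) • X x + (2 * α) • S.phi x (S.h x (X x)))
        - S.eta x (X x) • (-(α ^ 2 + c ^ 2) • Y x + (2 * α) • S.phi x (S.h x (Y x))) := by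
  have hφA : ∀ u : TangentSpace I x, S.phi x (S.nablaXi x u) = S.h x u + α • S.phi x u := by
    intro u
    rw [h_eq hS, sub_add_cancel]
  -- `φ (∇_u h) v` only sees the `ξ`-component of `v`, where `(∇_u h) ξ = -h (∇_u ξ)`.
  have hH : ∀ u v : TangentSpace I x, S.phi x (covH hS x u v)
      = S.eta x v • (c ^ 2 • (u - S.eta x u • S.xi x) - α • S.phi x (S.h x u)) := by
    intro u v
    have h1 := phi_covH_eq_zero hS hxi hpar u (S.sub_eta_smul_mem_D x v)
    have h2 : S.phi x (S.h x (S.nablaXi x u))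
        = α • S.phi x (S.h x u) - c ^ 2 • (u - S.eta x u • S.xi x) := by
      rw [← neg_neg (S.phi x (S.h x (S.nablaXi x u))), ← h_phi hS, hφA, map_add, map_smul,
        h_h hS hspec, h_phi hS]
      module
    rw [map_sub, map_smul, covH_xi, map_sub, map_smul, map_neg, h2] at h1
    rw [sub_eq_zero.mp h1]
    module
  -- `(∇_u φ) h v` is a multiple of `ξ`, with a coefficient symmetric in `u` and `v`.
  have hQ : ∀ u v : TangentSpace I x,
      S.covPhi x u (S.h x v) = inner ℝ (S.h x v) (S.phi x (S.nablaXi x u)) • S.xi x := by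
    intro u v
    have h1 : S.covPhi x u (S.h x v)
        = S.covPhi x (u - S.eta x u • S.xi x) (S.h x (v - S.eta x v • S.xi x)) := by
      simp [h_xi hS, covPhi_xi_left hS]
    have h2 := eq_eta_smul_xi fun w hw => inner_covPhi_h_eq_zero hS hxi hpar hspec
      (S.sub_eta_smul_mem_D x u) (S.sub_eta_smul_mem_D x v) hw
    rw [← h1, S.eta_eq_inner, S.inner_covPhi, S.covPhi_xi, inner_neg_right, neg_neg] at h2
    exact h2
  have hQsymm : inner ℝ (S.h x (X x)) (S.phi x (S.nablaXi x (Y x)))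
      = inner ℝ (S.h x (Y x)) (S.phi x (S.nablaXi x (X x))) := by
    have h1 := S.hasParity_phi x (S.h x (X x)) (Y x)
    have h2 := S.hasParity_phi x (S.h x (Y x)) (X x)
    have h3 := phi_h_symm hS x (X x) (Y x)
    rw [real_inner_comm (S.phi x _)] at h3
    rw [hφA, hφA, inner_add_right, inner_add_right, inner_smul_right, inner_smul_right,
      real_inner_comm (S.h x (X x))]
    linear_combination α * (h1 - h2 - h3)
  rw [curvature_xi_eq hS hX hY, hH, hH, hQ, hQ, hQsymm, nablaXi_eq hS, nablaXi_eq hS]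
  module

/-! ### The function `κ` -/

theorem contMDiff_sq_eigenvalue (hS : S.IsAlmostCosymplectic α) {lam : M → ℝ}
    (hspec : ∀ x, S.eigenD x (lam x) ⊔ S.eigenD x (-lam x) = S.D x)
    (hD : ∀ x, ∃ v ∈ S.D x, v ≠ 0) : CMDiff ∞ (fun x => lam x ^ 2) := by
  intro x
  obtain ⟨v, hv, hv0⟩ := hD x
  obtain ⟨Y, hY, hYD, rfl⟩ := exists_isSmoothField_D hv
  have hYY := hY.inner hY
  have h0 : inner ℝ (Y x) (Y x) ≠ 0 := inner_self_ne_zero.mpr hv0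
  have h1 : ContMDiffAt I 𝓘(ℝ, ℝ) ∞
      (fun y => inner ℝ (S.h y (Y y)) (S.h y (Y y)) / inner ℝ (Y y) (Y y)) x :=
    (((S.isSmoothEnd_h Y hY).inner (S.isSmoothEnd_h Y hY)) x).div₀ (hYY x) h0
  refine h1.congr_of_eventuallyEq ?_
  filter_upwards [hYY.continuous.continuousAt.eventually_ne h0] with y hy
  rw [inner_h_h hS (hspec y) (Y y) (hYD y), mul_div_assoc, div_self hy, mul_one]

/-- `λ²` is locally constant: differentiate `g(hY, hY) = λ² g(Y, Y)` for a field `Y` in `D`. -/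
theorem mvfderiv_sq_eigenvalue (hS : S.IsAlmostCosymplectic α)
    (hxi : ∀ Y : Π x : M, TangentSpace I x, IsSmoothField Y → ∀ x, nablaEnd S.h S.xi Y x = 0)
    (hpar : S.IsEtaParallel S.h) {lam : M → ℝ}
    (hspec : ∀ x, S.eigenD x (lam x) ⊔ S.eigenD x (-lam x) = S.D x)
    (hD : ∀ x, ∃ v ∈ S.D x, v ≠ 0) (x : M) (u : TangentSpace I x) :
    d% (fun x => lam x ^ 2) x u = 0 := by
  obtain ⟨v, hv, hv0⟩ := hD x
  obtain ⟨Y, hY, hYD, rfl⟩ := exists_isSmoothField_D hv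
  obtain ⟨X, hX, rfl⟩ := exists_isSmoothField u
  have hhY := S.isSmoothEnd_h Y hY
  have hf := contMDiff_sq_eigenvalue hS hspec hD
  have hYY := hY.inner hY
  have h1 : (fun y => inner ℝ (S.h y (Y y)) (S.h y (Y y)))
      = (fun x => lam x ^ 2) * fun y => inner ℝ (Y y) (Y y) := by
    ext y
    exact inner_h_h hS (hspec y) (Y y) (hYD y)
  have h2 := mvfderiv_inner hX hhY hhY x
  rw [h1, mvfderiv_mul ((hf x).mdifferentiableAt (by simp)) ((hYY x).mdifferentiableAt (by simp))]
    at h2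
  simp only [add_apply, smul_apply, smul_eq_mul] at h2
  rw [mvfderiv_inner hX hY hY, nabla_end_apply, nablaEnd_h hS hX hY, inner_add_left,
    real_inner_comm (_ + _), inner_add_left,
    inner_covH_eq_zero hS hxi hpar (X x) hv (mem_D.mpr (eta_h hS x (Y x))),
    inner_h_h hS (hspec x) _ hv, real_inner_comm (nabla X Y x) (Y x)] at h2
  have h3 : inner ℝ (Y x) (Y x) * d% (fun x => lam x ^ 2) x (X x) = 0 := by linarith
  exact (mul_eq_zero.mp h3).resolve_left (inner_self_ne_zero.mpr hv0)

theorem memREta_kappa (hS : S.IsAlmostCosymplectic α)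
    (hxi : ∀ Y : Π x : M, TangentSpace I x, IsSmoothField Y → ∀ x, nablaEnd S.h S.xi Y x = 0)
    (hpar : S.IsEtaParallel S.h) {lam : M → ℝ}
    (hspec : ∀ x, S.eigenD x (lam x) ⊔ S.eigenD x (-lam x) = S.D x)
    (hD : ∀ x, ∃ v ∈ S.D x, v ≠ 0) : S.MemREta (fun x => -(α ^ 2 + lam x ^ 2)) := by
  have hf := contMDiff_sq_eigenvalue hS hspec hD
  refine ⟨(contMDiff_const.add hf).neg, fun x v w => ?_⟩
  have h1 : ∀ u : TangentSpace I x, d% (fun x => -(α ^ 2 + lam x ^ 2)) x u = 0 := by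
    intro u
    have h2 : (fun x => -(α ^ 2 + lam x ^ 2)) = -((fun _ : M => α ^ 2) + fun x => lam x ^ 2) := rfl
    rw [h2, mvfderiv_neg, mvfderiv_add mdifferentiableAt_const
      ((hf x).mdifferentiableAt (by simp)), mvfderiv_const, zero_add, neg_apply,
      mvfderiv_sq_eigenvalue hS hxi hpar hspec hD, neg_zero]
  rw [h1, h1]
  ring

end AlmostCosymplectic

end AlmostContactMetricStructure

end AlmostContact

theorem mainTheorem6 (n : ℕ) (hn : 1 ≤ n)
    {M : Type*} [TopologicalSpace M] [T2Space M]
    [ChartedSpace (EuclideanSpace ℝ (Fin (2 * n + 1))) M] [IsManifold (𝓡 (2 * n + 1)) ∞ M]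
    [RiemannianBundle (fun x : M => TangentSpace (𝓡 (2 * n + 1)) x)]
    [IsContMDiffRiemannianBundle (𝓡 (2 * n + 1)) ∞ (EuclideanSpace ℝ (Fin (2 * n + 1)))
      (fun x : M => TangentSpace (𝓡 (2 * n + 1)) x)]
    (S : AlmostContact.AlmostContactMetricStructure (𝓡 (2 * n + 1)) M) (α : ℝ)
    (hS : S.IsAlmostCosymplectic α)
    (hxi : ∀ Y : Π x : M, TangentSpace (𝓡 (2 * n + 1)) x, AlmostContact.IsSmoothField Y →
      ∀ x, AlmostContact.nablaEnd S.h S.xi Y x = 0)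
    (hsec : ∃ p : M, ∀ X : Π x : M, TangentSpace (𝓡 (2 * n + 1)) x, AlmostContact.IsSmoothField X →
      LinearIndependent ℝ ![X p, S.xi p] → AlmostContact.sectionalCurvature X S.xi p ≠ α ^ 2)
    (lam : M → ℝ)
    (hspec : ∀ x, S.eigenD x (lam x) ⊔ S.eigenD x (-lam x) = S.D x)
    (hpar : S.IsEtaParallel S.h) :
    S.IsKappaMuNuSpace α (fun x => -(α ^ 2 + lam x ^ 2)) (fun _ => 0) (fun _ => 2 * α) := by
  have hD := S.exists_mem_D_ne_zero (by rw [finrank_euclideanSpace_fin]; omega)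
  have hconst : ∀ c : ℝ, S.MemREta (fun _ => c) := fun c =>
    ⟨contMDiff_const, fun x v w => by simp [mvfderiv_const]⟩
  refine ⟨hS, AlmostContact.AlmostContactMetricStructure.memREta_kappa hS hxi hpar hspec hD,
    hconst 0, hconst (2 * α), fun X Y hX hY x => ?_⟩
  simpa using AlmostContact.AlmostContactMetricStructure.curvature_xi_eq_kappa hS hxi hpar
    (hspec x) hX hY
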